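/- Let $k$ be an algebraically closed field and let $C$ be a semi-stable curve over $k$, i.e. a reduced, connected, one-dimensional, projective $k$-scheme all of whose singular points are nodes (points $P$ with $\widehat{\mathcal O}_{C,P}\cong k[[a,b]]/(ab)$ as $k$-algebras). Let $G\subset \mathrm{Aut}_k(C)$ be a finite subgroup whose order is coprime to $\mathrm{char}\,k$ (i.e. invertible in $k$), such that for every irreducible component of $C$ the stabiliser of that component in $G$ acts faithfully on it. Let $P\in C$ be a singular point, with stabiliser $\mathrm{Stab}(P)\subset G$. For $\sigma\in\mathrm{Stab}(P)$ let $\mathrm{sgn}_P(\sigma)\in\{1,-1\}$ be the sign of the permutation induced by $\sigma$ on the two edge ends of the graph of $C$ corresponding to $P$, i.e. on the two branches of $C$ at $P$ (the two minimal primes of $\widehat{\mathcal O}_{C,P}$). The action of $G$ is called orientation preserving at $P$ if every $\sigma\in\mathrm{Stab}(P)$ acts on the $k$-vector space $\mathfrak m_P/\mathfrak m_P^2$, where $\mathfrak m_P$ is the maximal ideal of $\widehat{\mathcal O}_{C,P}$, with determinant $\mathrm{sgn}_P(\sigma)$. Then the action of $G$ on $C$ is orientation preserving at $P$ if and only if there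 is an isomorphism of $k$-algebras $\widehat{\mathcal O}_{C,P}\cong k[[a,b]]/(ab)$ such that the induced action of $\mathrm{Stab}(P)$ on $k[[a,b]]/(ab)$ lifts to an action of $\mathrm{Stab}(P)$ on $k[[a,b]]$ by $k$-algebra automorphisms that fix the element $ab$. -/

import Mathlib

open CategoryTheory AlgebraicGeometry TopologicalSpace

universe u

namespace SemistableCurve

noncomputable section

/-! ### Completion of a local `k`-algebra -/

section Completion

variable {k : Type u} [Field k] {A : Type u} [CommRing A] [IsLocalRing A] [Algebra k A]

/-- The completion of a local ring at its maximal ideal. -/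
abbrev Completion (A : Type u) [CommRing A] [IsLocalRing A] : Type u :=
  AdicCompletion (IsLocalRing.maximalIdeal A) A

/-- The maximal ideal of the completion of a local ring `A`: the kernel of the natural map
onto the residue field of `A`. -/
def maxIdeal (A : Type u) [CommRing A] [IsLocalRing A] : Ideal (Completion A) :=
  RingHom.ker (AdicCompletion.evalOneₐ (IsLocalRing.maximalIdeal A))

theorem maximalIdeal_pow_le_comap (e : A ≃ₐ[k] A) (n : ℕ) :
    IsLocalRing.maximalIdeal A ^ n ≤
      (IsLocalRing.maximalIdeal A ^ n).comap (e : A →ₐ[k] A) := by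
  have h : IsLocalRing.maximalIdeal A ≤
      (IsLocalRing.maximalIdeal A).comap ((e : A →ₐ[k] A) : A →+* A) := by
    intro x hx
    rw [Ideal.mem_comap, IsLocalRing.mem_maximalIdeal, mem_nonunits_iff] at *
    intro hu
    apply hx
    simpa using hu.map e.symm
  exact (Ideal.pow_right_mono h n).trans (Ideal.le_comap_pow _ n)

/-- The map `A / 𝔪ⁿ → A / 𝔪ⁿ` induced by an automorphism of `A`. -/
def quotPowMap (e : A ≃ₐ[k] A) (n : ℕ) :
    (A ⧸ IsLocalRing.maximalIdeal A ^ n) →ₐ[k] (A ⧸ IsLocalRing.maximalIdeal A ^ n) :=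
  Ideal.quotientMapₐ _ (e : A →ₐ[k] A) (maximalIdeal_pow_le_comap e n)

theorem quotPowMap_mk (e : A ≃ₐ[k] A) (n : ℕ) (x : A) :
    quotPowMap e n (Ideal.Quotient.mk _ x) = Ideal.Quotient.mk _ (e x) := rfl

theorem completionMap_compat (e : A ≃ₐ[k] A) {m n : ℕ} (hle : m ≤ n) :
    (Ideal.Quotient.factorₐ k (Ideal.pow_le_pow_right hle)).comp
      ((quotPowMap e n).comp
        ((AdicCompletion.evalₐ (IsLocalRing.maximalIdeal A) n).restrictScalars k)) =
      (quotPowMap e m).comp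
        ((AdicCompletion.evalₐ (IsLocalRing.maximalIdeal A) m).restrictScalars k) := by
  ext x
  obtain ⟨y, rfl⟩ := AdicCompletion.mk_surjective _ _ x
  simp only [AlgHom.comp_apply, AlgHom.restrictScalars_apply, AdicCompletion.evalₐ_mk,
    quotPowMap_mk]
  change Ideal.Quotient.mk _ (e (y.1 n)) = Ideal.Quotient.mk _ (e (y.1 m))
  rw [← quotPowMap_mk, ← quotPowMap_mk]
  congr 1
  exact (AdicCompletion.Ideal.mk_eq_mk _ hle y)

/-- The endomorphism of the completion of `A` induced by an automorphism of `A`. -/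
def completionMap (e : A ≃ₐ[k] A) : Completion A →ₐ[k] Completion A :=
  AdicCompletion.liftAlgHom (IsLocalRing.maximalIdeal A)
    (fun n => (quotPowMap e n).comp
      ((AdicCompletion.evalₐ (IsLocalRing.maximalIdeal A) n).restrictScalars k))
    (completionMap_compat e)

theorem evalₐ_completionMap (e : A ≃ₐ[k] A) (n : ℕ) (x : Completion A) :
    AdicCompletion.evalₐ (IsLocalRing.maximalIdeal A) n (completionMap e x) =
      quotPowMap e n (AdicCompletion.evalₐ (IsLocalRing.maximalIdeal A) n x) :=
  AdicCompletion.evalₐ_liftAlgHom _ _ (completionMap_compat e) _ _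

/-- The action of the automorphisms of `A` on its completion. -/
def completionAut : (A ≃ₐ[k] A) →* (Completion A ≃ₐ[k] Completion A) :=
  (AlgEquiv.algHomUnitsEquiv k (Completion A)).toMonoidHom.comp
    (MonoidHom.toHomUnits
      { toFun := completionMap
        map_one' := by
          ext1 x
          refine AdicCompletion.ext_evalₐ fun n => ?_
          rw [evalₐ_completionMap]
          obtain ⟨y, hy⟩ := Ideal.Quotient.mk_surjective
            (AdicCompletion.evalₐ (IsLocalRing.maximalIdeal A) n x)
          rw [← hy, quotPowMap_mk]
          simpa using hy
        map_mul' := fun e f => by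
          ext1 x
          refine AdicCompletion.ext_evalₐ fun n => ?_
          rw [AlgHom.mul_apply, evalₐ_completionMap, evalₐ_completionMap, evalₐ_completionMap]
          obtain ⟨y, hy⟩ := Ideal.Quotient.mk_surjective
            (AdicCompletion.evalₐ (IsLocalRing.maximalIdeal A) n x)
          rw [← hy]
          rfl })

theorem completionAut_apply (e : A ≃ₐ[k] A) (x : Completion A) :
    completionAut e x = completionMap e x := rfl

theorem maxIdeal_le_comap (e : A ≃ₐ[k] A) :
    maxIdeal A ≤ (maxIdeal A).comap (completionAut e : Completion A →ₐ[k] Completion A) := by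
  have key : ∀ x : Completion A, x ∈ maxIdeal A ↔
      AdicCompletion.evalₐ (IsLocalRing.maximalIdeal A) 1 x = 0 := by
    intro x
    rw [maxIdeal, RingHom.mem_ker]
    have h := AdicCompletion.factorₐ_evalₐ_one (IsLocalRing.maximalIdeal A) x
    rw [← h]
    obtain ⟨y, hy⟩ := Ideal.Quotient.mk_surjective
      (AdicCompletion.evalₐ (IsLocalRing.maximalIdeal A) 1 x)
    rw [← hy, Ideal.Quotient.eq_zero_iff_mem]
    change Ideal.Quotient.mk _ y = 0 ↔ _
    rw [Ideal.Quotient.eq_zero_iff_mem, pow_one]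
  intro x hx
  rw [Ideal.mem_comap, key]
  rw [key] at hx
  change AdicCompletion.evalₐ (IsLocalRing.maximalIdeal A) 1 (completionMap e x) = 0
  rw [evalₐ_completionMap, hx, map_zero]

/-- The action of an automorphism of `A` on the cotangent space `𝔪 / 𝔪²` of the completion. -/
def cotangentAction (e : A ≃ₐ[k] A) :
    (maxIdeal A).Cotangent →ₗ[k] (maxIdeal A).Cotangent :=
  Ideal.mapCotangent _ _ (completionAut e : Completion A →ₐ[k] Completion A)
    (maxIdeal_le_comap e)

end Completion

/-! ### Permutation of the minimal primes induced by a ring automorphism -/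

theorem comap_symm_mem_minimalPrimes {k B : Type u} [Field k] [CommRing B] [Algebra k B]
    (e : B ≃ₐ[k] B) {q : Ideal B} (hq : q ∈ minimalPrimes B) :
    q.comap (e.symm : B →+* B) ∈ minimalPrimes B := by
  have := hq.1.1
  refine ⟨⟨Ideal.comap_isPrime _ _, bot_le⟩, fun p hp hle => ?_⟩
  have := hp.1
  have h1 : p.comap (e : B →+* B) ≤ q := by
    intro x hx
    have := hle (Ideal.mem_comap.1 hx)
    simpa using this
  have h2 := hq.2 ⟨Ideal.comap_isPrime (e : B →+* B) p, bot_le⟩ h1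
  intro x hx
  have := h2 (Ideal.mem_comap.1 hx)
  simpa using this

/-- An automorphism `e` of `B` permutes the minimal primes of `B` by `q ↦ e(q)`. -/
def minimalPrimesPerm {k B : Type u} [Field k] [CommRing B] [Algebra k B] (e : B ≃ₐ[k] B) :
    Equiv.Perm (minimalPrimes B) where
  toFun q := ⟨q.1.comap (e.symm : B →+* B), comap_symm_mem_minimalPrimes e q.2⟩
  invFun q := ⟨q.1.comap (e : B →+* B), comap_symm_mem_minimalPrimes e.symm q.2⟩
  left_inv q := by ext x; simp
  right_inv q := by ext x; simp

open Classical in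
/-- The sign of a permutation of a finite set (by convention `1` if the set is infinite). -/
def permSign {α : Type u} (e : Equiv.Perm α) : ℤˣ :=
  if _ : Finite α then
    letI : Fintype α := Fintype.ofFinite α
    Equiv.Perm.sign e
  else 1

/-! ### Semi-stable curves over an algebraically closed field -/

/-- The ring `k[[a, b]]` of formal power series in two variables. -/
abbrev PowerSeriesRing (k : Type u) [Field k] : Type u := MvPowerSeries (Fin 2) k

/-- The element `ab` of `k[[a, b]]`. -/
def ab (k : Type u) [Field k] : PowerSeriesRing k := MvPowerSeries.X 0 * MvPowerSeries.X 1

/-- The ring `k[[a, b]]/(ab)`. -/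
abbrev NodeRing (k : Type u) [Field k] : Type u := PowerSeriesRing k ⧸ Ideal.span {ab k}

section Curve

variable {k : Type u} [Field k]

attribute [local instance] MvPolynomial.gradedAlgebra

/-- The `k`-algebra structure on the local ring `𝒪_{C,P}` of a `k`-scheme `C`. -/
instance stalkAlgebra (C : Over (Spec (CommRingCat.of k))) (P : C.left) :
    Algebra k (C.left.presheaf.stalk P) :=
  ((Scheme.ΓSpecIso (CommRingCat.of k)).inv ≫ C.hom.appTop ≫
    C.left.presheaf.germ ⊤ P (Opens.mem_top P)).hom.toAlgebra

/-- The local ring `𝒪_{C,P}`. -/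
abbrev LocalRingAt (C : Over (Spec (CommRingCat.of k))) (P : C.left) : Type u :=
  C.left.presheaf.stalk P

/-- The completed local ring of `C` at `P`. -/
abbrev CompletedLocalRing (C : Over (Spec (CommRingCat.of k))) (P : C.left) : Type u :=
  Completion (LocalRingAt C P)

/-- `P` is a singular point of `C`. -/
def IsSingularPoint (C : Over (Spec (CommRingCat.of k))) (P : C.left) : Prop :=
  ¬ IsRegularLocalRing (LocalRingAt C P)

/-- `P` is a node (an ordinary double point) of `C`: its completed local ring is isomorphic
to `k[[a, b]]/(ab)` as a `k`-algebra. -/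
def IsNode (C : Over (Spec (CommRingCat.of k))) (P : C.left) : Prop :=
  Nonempty (CompletedLocalRing C P ≃ₐ[k] NodeRing k)

/-- `C` is projective over `k`: it is isomorphic over `k` to a closed subscheme of some
projective space `Proj k[x₀, …, xₙ]`. -/
def IsProjective (C : Over (Spec (CommRingCat.of k))) : Prop :=
  ∃ (n : ℕ) (i : C.left ⟶ Proj (MvPolynomial.homogeneousSubmodule (Fin (n + 1)) k)),
    IsClosedImmersion i ∧
      i ≫ Proj.toSpecZero (MvPolynomial.homogeneousSubmodule (Fin (n + 1)) k) ≫
        Spec.map (CommRingCat.ofHom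
          (algebraMap k (MvPolynomial.homogeneousSubmodule (Fin (n + 1)) k 0))) = C.hom

/-- Semi-stable curves over an algebraically closed field `k`. -/
structure IsSemistable (C : Over (Spec (CommRingCat.of k))) : Prop where
  reduced : IsReduced C.left
  connected : ConnectedSpace C.left
  oneDimensional : topologicalKrullDim C.left = 1
  projective : IsProjective C
  nodal : ∀ P : C.left, IsSingularPoint C P → IsNode C P

/-! ### Group actions -/

/-- `G` acts faithfully on components: for each irreducible component `Z` of `C` (with its reduced
scheme structure), an element of `G` that stabilises `Z` and acts on `Z` as the identity is
trivial. -/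
def FaithfulOnComponents (C : Over (Spec (CommRingCat.of k))) (G : Subgroup (Aut C)) : Prop :=
  ∀ Z : Closeds C.left, (Z : Set C.left) ∈ irreducibleComponents C.left →
    ∀ g ∈ G, g.hom.left '' (Z : Set C.left) = Z →
      (Scheme.IdealSheafData.vanishingIdeal Z).subschemeι ≫ g.hom.left =
        (Scheme.IdealSheafData.vanishingIdeal Z).subschemeι → g = 1

theorem inv_left_fixes {C : Over (Spec (CommRingCat.of k))} (e : C ≅ C) (P : C.left)
    (h : e.hom.left P = P) : e.inv.left P = P := by
  have h' : (e.hom ≫ e.inv).left P = P := by rw [Iso.hom_inv_id]; rfl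
  rw [Over.comp_left, Scheme.Hom.comp_apply, h] at h'
  exact h'

/-- The stabiliser in `G` of a point `P`. -/
def Stab {C : Over (Spec (CommRingCat.of k))} (G : Subgroup (Aut C)) (P : C.left) :
    Subgroup (Aut C) where
  carrier := {g | g ∈ G ∧ g.hom.left P = P}
  one_mem' := ⟨G.one_mem, rfl⟩
  mul_mem' := by
    rintro g h ⟨hg, hgP⟩ ⟨hh, hhP⟩
    refine ⟨G.mul_mem hg hh, ?_⟩
    change (h.hom ≫ g.hom).left P = P
    simp [hhP, hgP]
  inv_mem' := by
    rintro g ⟨hg, hgP⟩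
    refine ⟨G.inv_mem hg, ?_⟩
    exact inv_left_fixes g P hgP

/-- Pull-back of germs `𝒪_{C,P} → 𝒪_{C,P}` along an endomorphism `f` of `C` that fixes `P`. -/
def stalkPullback {C : Over (Spec (CommRingCat.of k))} (f : C ⟶ C) (P : C.left)
    (h : f.left P = P) : LocalRingAt C P →ₐ[k] LocalRingAt C P where
  toRingHom := (C.left.presheaf.stalkSpecializes (specializes_of_eq h) ≫ f.left.stalkMap P).hom
  commutes' r := by
    have h1 : f.left ≫ C.hom = C.hom := Over.w f
    have h2 : C.hom.appTop ≫ f.left.appTop = C.hom.appTop := by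
      rw [← Scheme.Hom.comp_appTop, h1]
    have h3 : (Scheme.ΓSpecIso (CommRingCat.of k)).inv ≫ C.hom.appTop ≫
        C.left.presheaf.germ ⊤ P (Opens.mem_top P) ≫
        C.left.presheaf.stalkSpecializes (specializes_of_eq h) ≫ f.left.stalkMap P =
        (Scheme.ΓSpecIso (CommRingCat.of k)).inv ≫ C.hom.appTop ≫
        C.left.presheaf.germ ⊤ P (Opens.mem_top P) := by
      rw [TopCat.Presheaf.germ_stalkSpecializes_assoc, Scheme.Hom.germ_stalkMap]
      conv_rhs => rw [← h2]
      rw [Category.assoc]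
      rfl
    exact congr($(h3).hom r)

theorem stalkPullback_id {C : Over (Spec (CommRingCat.of k))} (P : C.left) :
    stalkPullback (𝟙 C) P rfl = AlgHom.id k _ := by
  have h : C.left.presheaf.stalkSpecializes (specializes_rfl (x := P)) ≫
      (𝟙 C.left : C.left ⟶ C.left).stalkMap P = 𝟙 _ := by
    rw [Scheme.Hom.stalkMap_id, TopCat.Presheaf.stalkSpecializes_refl]
    rfl
  ext x
  exact congr($(h).hom x)

theorem stalkPullback_comp {C : Over (Spec (CommRingCat.of k))} (f g : C ⟶ C) (P : C.left)
    (hf : f.left P = P) (hg : g.left P = P) (hfg : (f ≫ g).left P = P) :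
    stalkPullback (f ≫ g) P hfg = (stalkPullback f P hf).comp (stalkPullback g P hg) := by
  have h : C.left.presheaf.stalkSpecializes (specializes_of_eq hfg) ≫
      (f.left ≫ g.left).stalkMap P =
      (C.left.presheaf.stalkSpecializes (specializes_of_eq hg) ≫ g.left.stalkMap P) ≫
      (C.left.presheaf.stalkSpecializes (specializes_of_eq hf) ≫ f.left.stalkMap P) := by
    rw [Scheme.Hom.stalkMap_comp, Category.assoc,
      ← Scheme.Hom.stalkSpecializes_stalkMap_assoc g.left _ _ (specializes_of_eq hf),
      TopCat.Presheaf.stalkSpecializes_comp_assoc]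
    rfl
  ext x
  exact congr($(h).hom x)

/-- The (left) action of `Stab(P)` on `𝒪_{C,P}`: the element `σ` acts by pull-back of germs
along `σ⁻¹`. -/
def stalkAction {C : Over (Spec (CommRingCat.of k))} (G : Subgroup (Aut C)) (P : C.left) :
    Stab G P →* (LocalRingAt C P ≃ₐ[k] LocalRingAt C P) :=
  (AlgEquiv.algHomUnitsEquiv k (LocalRingAt C P)).toMonoidHom.comp
    (MonoidHom.toHomUnits
      { toFun := fun σ => stalkPullback σ.1.inv P ((Stab G P).inv_mem σ.2).2
        map_one' := stalkPullback_id P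
        map_mul' := fun σ τ => stalkPullback_comp σ.1.inv τ.1.inv P _ _ _ })

/-- The induced action of `Stab(P)` on the completed local ring at `P`. -/
def completedAction {C : Over (Spec (CommRingCat.of k))} (G : Subgroup (Aut C)) (P : C.left) :
    Stab G P →* (CompletedLocalRing C P ≃ₐ[k] CompletedLocalRing C P) :=
  completionAut.comp (stalkAction G P)

/-- The edge ends at a node `P` of the graph associated to `C`, i.e. the branches of `C` at `P`:
the minimal primes of the completed local ring. A node has two of them (the ideals generated by
`a` and by `b`), also if they lie on the same irreducible component of `C`. -/
abbrev EdgeEnds (C : Over (Spec (CommRingCat.of k))) (P : C.left) : Type u :=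
  minimalPrimes (CompletedLocalRing C P)

/-- `sgn_P(σ)`: the sign of the permutation of the edge ends at `P` induced by `σ`. -/
def sgn {C : Over (Spec (CommRingCat.of k))} (G : Subgroup (Aut C)) (P : C.left)
    (σ : Stab G P) : ℤˣ :=
  permSign (α := EdgeEnds C P) (minimalPrimesPerm (completedAction G P σ))

/-- The action of `G` on `C` is orientation preserving at `P`: each `σ ∈ Stab(P)` acts on the
cotangent space at `P` with determinant `sgn_P(σ)`. -/
def OrientationPreservingAt {C : Over (Spec (CommRingCat.of k))} (G : Subgroup (Aut C))
    (P : C.left) : Prop :=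
  ∀ σ : Stab G P, LinearMap.det (cotangentAction (stalkAction G P σ)) = ((sgn G P σ : ℤ) : k)

end Curve

end

end SemistableCurve

open SemistableCurve

/-! Fix an isomorphism of the completed local ring with k[[a,b]]/(ab). An automorphism of this ring
permutes the minimal primes (a) and (b), so it acts on the cotangent space by a monomial matrix M
(`linearPart`). The determinant of M is the sign of that permutation times the product of the
nonzero entries, and this product is `M 0 0 * M 1 1 + M 0 1 * M 1 0`. Hence, whichever isomorphism
is chosen, preserving orientation means that this expression is 1 for every element of the
stabiliser (`det_cotangentAction_eq_permSign_iff`).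

If it is 1, average the coordinates over the stabiliser, whose order divides that of G and so is
invertible. In the new coordinates the action is linear (`exists_linearise`), so it lifts to
k[[a,b]] by linear substitutions, and these fix ab (`linearSubst_linearPart_ab`). The delicate point
is that the averaged coordinates stay multiples of the old ones (`nodeVar_dvd_averagedVar`), so that
their product is still 0; that they are coordinates at all follows by successive approximation
(`bijective_of_le_order_sub`).

Conversely, if a lift fixes ab, the images p, q of a, b satisfy pq = ab. The coefficient of ab in pq
is the same expression in the linear coefficients, so it is 1 (`linearCoeff_mk_of_mul_eq_ab`). -/

namespace SemistableCurve

noncomputable section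

/-! ### Power series in two variables: order, substitution, restriction to the axes. -/

section PowerSeriesRing

open MvPowerSeries

variable {k : Type u} [Field k]

/-- Sort the monomials: those involving `X 0` go into `g 0`, the nonconstant powers of `X 1` into `g
1`. Dividing by a variable lowers the order by at most one, which lets inductions on the order run.
-/
theorem exists_eq_C_add (f : PowerSeriesRing k) (n : ℕ) (hf : (n : ℕ∞) ≤ f.order) :
    ∃ g : Fin 2 → PowerSeriesRing k,
      f = C (constantCoeff f) + X 0 * g 0 + X 1 * g 1 ∧ ∀ i, (n : ℕ∞) ≤ (g i).order + 1 := by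
  classical
  have shift (i : Fin 2) (g : PowerSeriesRing k) (h : (n : ℕ∞) ≤ (X i * g).order) :
      (n : ℕ∞) ≤ g.order + 1 := by
    rcases n with _ | n
    · simp
    push_cast
    refine add_le_add_left (le_order fun d hd => ?_) 1
    have := coeff_of_lt_order (f := X i * g) (d := Finsupp.single i 1 + d) (lt_of_lt_of_le ?_ h)
    · rwa [X, coeff_add_monomial_mul, one_mul] at this
    · rw [map_add, Finsupp.degree_single, add_comm]
      push_cast
      exact_mod_cast Nat.add_lt_add_right (by exact_mod_cast hd) 1
  let f1 : PowerSeriesRing k := fun d => if d 0 = 0 then coeff d f else 0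
  let f2 : PowerSeriesRing k := fun d => if d 0 = 0 ∧ d 1 ≠ 0 then coeff d f else 0
  have c1 (d) : coeff d f1 = if d 0 = 0 then coeff d f else 0 := rfl
  have c2 (d) : coeff d f2 = if d 0 = 0 ∧ d 1 ≠ 0 then coeff d f else 0 := rfl
  have d0 : (X 0 : PowerSeriesRing k) ∣ f - f1 := by
    rw [X_dvd_iff]
    intro m hm
    simp [c1, hm]
  have d1 : (X 1 : PowerSeriesRing k) ∣ f2 := by
    rw [X_dvd_iff]
    intro m hm
    simp [c2, hm]
  have d2 : f1 = C (constantCoeff f) + f2 := by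
    ext m
    rw [map_add, c1, c2, coeff_C]
    by_cases h0 : m 0 = 0 <;> by_cases h1 : m 1 = 0
    · have : m = 0 := by ext i; fin_cases i <;> simpa
      simp [this]
    · have : m ≠ 0 := by rintro rfl; simp at h1
      simp [h0, h1, this]
    all_goals
      have : m ≠ 0 := by rintro rfl; simp at h0
      simp [h0, this]
  obtain ⟨g, hg⟩ := d0
  obtain ⟨h, hh⟩ := d1
  refine ⟨![g, h], ?_, ?_⟩
  · simp only [Matrix.cons_val_zero, Matrix.cons_val_one, ← hg, ← hh]
    rw [add_assoc, add_comm (f - f1), ← add_assoc, ← d2]; ring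
  · intro i
    fin_cases i
    · refine shift 0 g (le_order fun d hd => ?_)
      rw [← hg, map_sub, c1, coeff_of_lt_order (lt_of_lt_of_le hd hf)]
      simp
    · refine shift 1 h (le_order fun d hd => ?_)
      rw [← hh, c2, coeff_of_lt_order (lt_of_lt_of_le hd hf)]
      simp

/-- Two homomorphisms out of `k[[a, b]]` that agree on the variables and send them into an
ideal with trivial intersection of powers are equal. -/
theorem algHom_ext_of_iInf_pow_eq_bot {S : Type*} [CommRing S] [Algebra k S] {J : Ideal S}
    (hJ : ⨅ n : ℕ, J ^ n = ⊥) {F G : PowerSeriesRing k →ₐ[k] S}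
    (hF : ∀ i, F (X i) ∈ J) (h : ∀ i, F (X i) = G (X i)) : F = G := by
  -- No continuity is needed: splitting off one variable from `f` gains one factor `F (X i) ∈ J`.
  have key (n : ℕ) : ∀ f, F f - G f ∈ J ^ n := by
    induction n with
    | zero => simp
    | succ n ih =>
      intro f
      obtain ⟨g, hg, -⟩ := exists_eq_C_add f 0 (by simp)
      have hC (c : k) : F (C c) = G (C c) := (F.commutes c).trans (G.commutes c).symm
      rw [hg]
      simp only [map_add, map_mul, hC, ← h]
      have : ∀ i, F (X i) * (F (g i) - G (g i)) ∈ J ^ (n + 1) := fun i => by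
        rw [pow_succ']
        exact Ideal.mul_mem_mul (hF i) (ih _)
      convert add_mem (this 0) (this 1) using 1
      ring
  ext1 f
  rw [← sub_eq_zero, ← Ideal.mem_bot, ← hJ, Ideal.mem_iInf]
  exact fun n => key n f

theorem iInf_pow_ker_constantCoeff :
    ⨅ n : ℕ, RingHom.ker (constantCoeff (σ := Fin 2) (R := k)) ^ n = ⊥ := by
  have key (n : ℕ) : ∀ f ∈ RingHom.ker (constantCoeff (σ := Fin 2) (R := k)) ^ n,
      (n : ℕ∞) ≤ f.order := by
    induction n with
    | zero => simp
    | succ n ih =>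
      intro f hf
      rw [pow_succ] at hf
      refine Submodule.mul_induction_on hf (fun a ha b hb => ?_) fun a b ha hb => ?_
      · refine le_trans ?_ le_order_mul
        push_cast
        exact add_le_add (ih a ha) (one_le_order_iff_constCoeff_eq_zero.2 hb)
      · exact le_trans (le_min ha hb) min_order_le_add
  rw [eq_bot_iff]
  intro f hf
  rw [Ideal.mem_iInf] at hf
  rw [Ideal.mem_bot, ← order_eq_top_iff]
  exact ENat.eq_top_iff_forall_ge.2 fun n => key n f (hf n)

theorem algHom_ext_powerSeriesRing {F G : PowerSeriesRing k →ₐ[k] PowerSeriesRing k}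
    (hF : ∀ i, constantCoeff (F (X i)) = 0) (h : ∀ i, F (X i) = G (X i)) : F = G :=
  algHom_ext_of_iInf_pow_eq_bot iInf_pow_ker_constantCoeff hF h

/-- `F` is the identity plus an operator that raises the order. A kernel element then has
arbitrarily large order. A preimage of `w` is the limit of the iteration y ↦ w - (F y - y), whose
successive differences have growing order. -/
theorem bijective_of_le_order_sub (F : PowerSeriesRing k →ₗ[k] PowerSeriesRing k)
    (hF : ∀ (n : ℕ) (f : PowerSeriesRing k), (n : ℕ∞) ≤ f.order →
      ((n + 1 : ℕ) : ℕ∞) ≤ (F f - f).order) :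
    Function.Bijective F := by
  constructor
  · rw [injective_iff_map_eq_zero]
    intro f hf
    rw [← order_eq_top_iff]
    refine ENat.eq_top_iff_forall_ge.2 fun n => ?_
    induction n with
    | zero => simp
    | succ n ih =>
      have := hF n f ih
      rwa [hf, zero_sub, order_neg] at this
  · intro w
    let z : ℕ → PowerSeriesRing k := fun n => (fun y => w - (F y - y))^[n] 0
    have hz (n) : z (n + 1) = w - (F (z n) - z n) := Function.iterate_succ_apply' _ _ _
    have hstep (n : ℕ) : (n : ℕ∞) ≤ (z (n + 1) - z n).order := by
      induction n with
      | zero => simp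
      | succ n ih =>
        have := hF n _ ih
        rw [← order_neg] at this
        have e : z (n + 1 + 1) - z (n + 1) =
            -(F (z (n + 1) - z n) - (z (n + 1) - z n)) := by
          rw [hz (n + 1), map_sub]
          linear_combination -hz n
        rwa [e]
    have hle (n m : ℕ) : (n : ℕ∞) ≤ (z (n + m) - z n).order := by
      induction m with
      | zero => simp
      | succ m ih =>
        have : z (n + (m + 1)) - z n = (z (n + m + 1) - z (n + m)) + (z (n + m) - z n) := by
          rw [add_assoc]; ring
        rw [this]
        refine le_trans (le_min (le_trans ?_ (hstep (n + m))) ih) min_order_le_add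
        exact_mod_cast Nat.le_add_right n m
    -- Order at least n controls only degrees below n, so a coefficient of degree e is stable from
    -- `z (e + 1)` on.
    let y : PowerSeriesRing k := fun d => coeff d (z (d.degree + 1))
    have hy (n : ℕ) : (n : ℕ∞) ≤ (y - z n).order := by
      refine nat_le_order fun d hd => ?_
      obtain ⟨m, rfl⟩ := Nat.exists_eq_add_of_le (Nat.succ_le_of_lt hd)
      have := coeff_of_lt_order (d := d) (lt_of_lt_of_le (by exact_mod_cast Nat.lt_succ_self _)
        (hle (d.degree + 1) m))
      rw [map_sub, sub_eq_zero] at this ⊢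
      exact this.symm
    refine ⟨y, ?_⟩
    rw [← sub_eq_zero, ← order_eq_top_iff]
    refine ENat.eq_top_iff_forall_ge.2 fun n => ?_
    have e : F y - w = (F (y - z n) - (y - z n)) + (y - z (n + 1)) := by
      rw [hz n, map_sub]; ring
    rw [e]
    refine le_trans (le_min ?_ ?_) min_order_le_add
    · exact le_trans (by exact_mod_cast Nat.le_succ n) (hF n _ (hy n))
    · exact le_trans (by exact_mod_cast Nat.le_succ n) (hy (n + 1))

/-- The endomorphism of `k[[a, b]]` given by substitution of power series without constant term. -/
def substHom (p : Fin 2 → PowerSeriesRing k) (hp : ∀ i, constantCoeff (p i) = 0) :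
    PowerSeriesRing k →ₐ[k] PowerSeriesRing k :=
  substAlgHom (hasSubst_of_constantCoeff_zero hp)

@[simp]
theorem substHom_X (p : Fin 2 → PowerSeriesRing k) (hp : ∀ i, constantCoeff (p i) = 0) (i : Fin 2) :
    substHom p hp (X i) = p i :=
  substAlgHom_X _ i

theorem bijective_of_map_X {F : PowerSeriesRing k →ₐ[k] PowerSeriesRing k}
    {U : Fin 2 → PowerSeriesRing k}
    (hU : ∀ i, constantCoeff (U i) = 1) (hF : ∀ i, F (X i) = U i * X i) :
    Function.Bijective F := by
  refine bijective_of_le_order_sub F.toLinearMap fun n => ?_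
  induction n with
  | zero =>
    intro f hf
    obtain ⟨g, hg, -⟩ := exists_eq_C_add f 0 hf
    have hC (c : k) : F (C c) = C c := F.commutes c
    rw [hg]
    refine le_of_eq_of_le (by simp) (one_le_order_iff_constCoeff_eq_zero.2 ?_)
    simp [hF, hC]
  | succ n ih =>
    intro f hf
    obtain ⟨g, hg, hn⟩ := exists_eq_C_add f (n + 1) hf
    have h0 : constantCoeff f = 0 := by
      rw [← one_le_order_iff_constCoeff_eq_zero]
      exact le_trans (by simp) hf
    have hn (i) : (n : ℕ∞) ≤ (g i).order := by
      have := hn i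
      push_cast at this
      exact (ENat.add_le_add_iff_right (by simp)).1 this
    have key (i) : ((n + 1 + 1 : ℕ) : ℕ∞) ≤ (X i * (U i * F (g i) - g i)).order := by
      refine le_trans ?_ le_order_mul
      rw [add_comm]
      push_cast
      -- Each summand has order at least n + 1: either `U i - 1` supplies the extra degree, or the
      -- induction hypothesis for `g i` does.
      have e : U i * F (g i) - g i =
          ((U i - 1) * (F (g i) - g i) + (U i - 1) * g i) + (F (g i) - g i) := by ring
      have h1 : 1 ≤ (U i - 1).order := by
        rw [one_le_order_iff_constCoeff_eq_zero]; simp [hU]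
      have h2 := ih (g i) (hn i)
      push_cast at h2
      simp only [AlgHom.toLinearMap_apply] at h2
      rw [add_comm (1 : ℕ∞), add_comm]
      refine add_le_add ?_ ?_
      · rw [one_le_order_iff_constCoeff_eq_zero]; simp
      · rw [e]
        refine le_trans (le_min (le_trans (le_min ?_ ?_) min_order_le_add) h2) min_order_le_add
        · exact le_trans (le_trans h2 le_add_self) le_order_mul
        · refine le_trans ?_ le_order_mul
          rw [add_comm]
          exact add_le_add h1 (hn i)
    have e : F.toLinearMap f - f = X 0 * (U 0 * F (g 0) - g 0) + X 1 * (U 1 * F (g 1) - g 1) := by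
      conv_lhs => rw [hg, h0]
      simp [hF]
      ring
    rw [e]
    exact le_trans (le_min (key 0) (key 1)) min_order_le_add

/-- Restriction of a power series to the `i`-th coordinate axis. -/
def axis (i : Fin 2) : PowerSeriesRing k →ₐ[k] PowerSeries k where
  toFun f := PowerSeries.mk fun n => coeff (Finsupp.single i n) f
  map_one' := by
    classical
    ext n
    simp [coeff_one, PowerSeries.coeff_one]
  map_zero' := by ext n; simp
  map_add' f g := by ext n; simp
  map_mul' f g := by
    classical
    ext n
    simp [coeff_mul, PowerSeries.coeff_mul, Finsupp.antidiagonal_single, Finset.sum_map]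
  commutes' r := by
    classical
    ext n
    simp [MvPowerSeries.algebraMap_apply, coeff_C, PowerSeries.coeff_C]

theorem coeff_axis (i : Fin 2) (f : PowerSeriesRing k) (n : ℕ) :
    PowerSeries.coeff n (axis i f) = coeff (Finsupp.single i n) f := by
  exact PowerSeries.coeff_mk n fun n => coeff (Finsupp.single i n) f

@[simp]
theorem axis_X_self (i : Fin 2) : axis i (X i : PowerSeriesRing k) = PowerSeries.X := by
  classical
  ext n
  rw [coeff_axis, coeff_X, PowerSeries.coeff_X]
  simp only [(Finsupp.single_injective i).eq_iff]

theorem axis_X_of_ne {i j : Fin 2} (h : i ≠ j) : axis i (X j : PowerSeriesRing k) = 0 := by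
  classical
  ext n
  rw [coeff_axis, coeff_X]
  simp [Finsupp.single_eq_single_iff, h]

@[simp]
theorem constantCoeff_axis (i : Fin 2) (f : PowerSeriesRing k) :
    PowerSeries.constantCoeff (axis i f) = constantCoeff f := by
  rw [← PowerSeries.coeff_zero_eq_constantCoeff_apply, coeff_axis]
  simp

/-- With only two variables, a monomial free of `X j` is a power of `X i`, so its coefficient is
seen on the `i`-th axis. -/
theorem X_dvd_of_axis_eq_zero {i j : Fin 2} (h : i ≠ j) {f : PowerSeriesRing k}
    (hf : axis i f = 0) : (X j : PowerSeriesRing k) ∣ f := by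
  rw [X_dvd_iff]
  intro m hm
  have : m = Finsupp.single i (m i) := by
    ext l
    rcases eq_or_ne l i with rfl | hl
    · simp
    · have : l = j := by omega
      subst this
      simp [hm, h]
  rw [this, ← coeff_axis, hf, map_zero]

end PowerSeriesRing

/-! ### The node k[[a,b]]/(ab): branches, maximal ideal, linear parts of automorphisms. -/

section NodeRing

variable {k : Type u} [Field k]

/-- The image in `k[[a, b]]/(ab)` of one of the variables. -/
def nodeVar (k : Type u) [Field k] (i : Fin 2) : NodeRing k :=
  Ideal.Quotient.mk _ (MvPowerSeries.X i)

theorem nodeVar_mul {i j : Fin 2} (h : i ≠ j) : nodeVar k i * nodeVar k j = 0 := by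
  have : nodeVar k 0 * nodeVar k 1 = 0 :=
    Ideal.Quotient.eq_zero_iff_mem.2 (Ideal.mem_span_singleton_self (ab k))
  fin_cases i <;> fin_cases j
  · simp at h
  · exact this
  · rw [mul_comm]; exact this
  · simp at h

theorem axis_ab (i : Fin 2) : axis i (ab k) = 0 := by
  fin_cases i
  · simp [ab, axis_X_of_ne (k := k) (i := 0) (j := 1) (by simp)]
  · simp [ab, axis_X_of_ne (k := k) (i := 1) (j := 0) (by simp)]

/-- Restriction of a function on the node to its `i`-th branch. -/
def branch (i : Fin 2) : NodeRing k →ₐ[k] PowerSeries k :=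
  Ideal.Quotient.liftₐ _ (axis i) fun a ha => by
    obtain ⟨c, rfl⟩ := Ideal.mem_span_singleton.1 ha
    rw [map_mul, axis_ab, zero_mul]

@[simp]
theorem branch_mk (i : Fin 2) (f : PowerSeriesRing k) :
    branch i (Ideal.Quotient.mk _ f) = axis i f := rfl

@[simp]
theorem branch_nodeVar_self (i : Fin 2) : branch i (nodeVar k i) = PowerSeries.X := by
  simp [nodeVar]

theorem branch_nodeVar_of_ne {i j : Fin 2} (h : i ≠ j) : branch i (nodeVar k j) = 0 :=
  axis_X_of_ne h

theorem branch_eq_zero_iff {i j : Fin 2} (h : i ≠ j) {z : NodeRing k} :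
    branch i z = 0 ↔ nodeVar k j ∣ z := by
  constructor
  · obtain ⟨f, rfl⟩ := Ideal.Quotient.mk_surjective z
    intro hf
    exact map_dvd _ (X_dvd_of_axis_eq_zero h hf)
  · rintro ⟨w, rfl⟩
    rw [map_mul, branch_nodeVar_of_ne h, zero_mul]

theorem ker_branch {i j : Fin 2} (h : i ≠ j) :
    RingHom.ker (branch (k := k) i) = Ideal.span {nodeVar k j} := by
  ext z
  rw [RingHom.mem_ker, branch_eq_zero_iff h, Ideal.mem_span_singleton]

/-- The node embeds into the product of its two branches, which reduces many questions to k[[t]]. -/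
theorem eq_zero_of_branch_eq_zero {z : NodeRing k} (h : ∀ i, branch i z = 0) : z = 0 := by
  obtain ⟨w, rfl⟩ := (branch_eq_zero_iff (i := 0) (j := 1) (by simp)).1 (h 0)
  have h1 := h 1
  rw [map_mul, branch_nodeVar_self, mul_eq_zero, or_iff_right PowerSeries.X_ne_zero,
    branch_eq_zero_iff (j := 0) (by simp)] at h1
  obtain ⟨v, rfl⟩ := h1
  rw [← mul_assoc, nodeVar_mul (by simp), zero_mul]

instance : Nontrivial (NodeRing k) := (branch (k := k) 0).toRingHom.domain_nontrivial

instance : IsLocalRing (NodeRing k) :=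
  IsLocalRing.of_surjective' (Ideal.Quotient.mk _) Ideal.Quotient.mk_surjective

theorem mem_maximalIdeal_iff (i : Fin 2) {z : NodeRing k} :
    z ∈ IsLocalRing.maximalIdeal (NodeRing k) ↔ PowerSeries.constantCoeff (branch i z) = 0 := by
  let F : NodeRing k →+* k := (PowerSeries.constantCoeff).comp (branch i).toRingHom
  have hF : Function.Surjective F := fun c => ⟨algebraMap k _ c, by simp [F]⟩
  have := RingHom.ker_isMaximal_of_surjective F hF
  rw [← IsLocalRing.eq_maximalIdeal this, RingHom.mem_ker]
  rfl

theorem nodeVar_mem_maximalIdeal (i : Fin 2) :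
    nodeVar k i ∈ IsLocalRing.maximalIdeal (NodeRing k) := by
  simp [mem_maximalIdeal_iff i]

theorem iInf_maximalIdeal_pow : ⨅ n : ℕ, IsLocalRing.maximalIdeal (NodeRing k) ^ n = ⊥ := by
  rw [eq_bot_iff]
  intro z hz
  rw [Ideal.mem_iInf] at hz
  refine eq_zero_of_branch_eq_zero fun i => ?_
  ext n
  have hle : IsLocalRing.maximalIdeal (NodeRing k) ≤
      (Ideal.span {(PowerSeries.X : PowerSeries k)}).comap (branch i) := fun w hw => by
    rw [Ideal.mem_comap, Ideal.mem_span_singleton, PowerSeries.X_dvd_iff]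
    exact (mem_maximalIdeal_iff i).1 hw
  have := (Ideal.pow_right_mono hle (n + 1)).trans (Ideal.le_comap_pow _ _) (hz (n + 1))
  rw [Ideal.mem_comap, Ideal.span_singleton_pow, Ideal.mem_span_singleton,
    PowerSeries.X_pow_dvd_iff] at this
  rw [this n (Nat.lt_succ_self n), map_zero]

theorem exists_eq_sum_nodeVar {z : NodeRing k} (hz : z ∈ IsLocalRing.maximalIdeal (NodeRing k)) :
    ∃ w : Fin 2 → NodeRing k, z = ∑ i, nodeVar k i * w i := by
  obtain ⟨f, rfl⟩ := Ideal.Quotient.mk_surjective z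
  rw [mem_maximalIdeal_iff 0, branch_mk, constantCoeff_axis] at hz
  obtain ⟨g, hg, -⟩ := exists_eq_C_add f 0 (by simp)
  refine ⟨fun i => Ideal.Quotient.mk _ (g i), ?_⟩
  conv_lhs => rw [hg, hz]
  simp [nodeVar]

theorem map_mem_maximalIdeal (e : NodeRing k ≃ₐ[k] NodeRing k) {z : NodeRing k} :
    e z ∈ IsLocalRing.maximalIdeal (NodeRing k) ↔ z ∈ IsLocalRing.maximalIdeal (NodeRing k) := by
  simp only [IsLocalRing.mem_maximalIdeal, mem_nonunits_iff, MulEquiv.isUnit_map]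

/-- The residue field is k, so a k-automorphism preserves residues; both branches see the same
residue, hence the independent indices. -/
theorem constantCoeff_branch_map (e : NodeRing k ≃ₐ[k] NodeRing k) (i j : Fin 2)
    (z : NodeRing k) : PowerSeries.constantCoeff (branch i (e z)) =
      PowerSeries.constantCoeff (branch j z) := by
  have h : z - algebraMap k _ (PowerSeries.constantCoeff (branch j z)) ∈
      IsLocalRing.maximalIdeal (NodeRing k) := by
    rw [mem_maximalIdeal_iff j]
    simp
  rw [← map_mem_maximalIdeal e, mem_maximalIdeal_iff i] at h
  simpa [sub_eq_zero] using h

/-- The coefficient of the `i`-th variable. -/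
def linearCoeff (i : Fin 2) : NodeRing k →ₗ[k] k :=
  PowerSeries.coeff 1 ∘ₗ (branch i).toLinearMap

theorem linearCoeff_apply (i : Fin 2) (z : NodeRing k) :
    linearCoeff i z = PowerSeries.coeff 1 (branch i z) := rfl

theorem linearCoeff_mul (i : Fin 2) {z w : NodeRing k}
    (hz : z ∈ IsLocalRing.maximalIdeal (NodeRing k)) :
    linearCoeff i (z * w) = linearCoeff i z * PowerSeries.constantCoeff (branch i w) := by
  rw [mem_maximalIdeal_iff i] at hz
  rw [linearCoeff_apply, map_mul, PowerSeries.coeff_mul, linearCoeff_apply,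
    Finset.Nat.sum_antidiagonal_eq_sum_range_succ_mk]
  simp [Finset.sum_range_succ, hz]

theorem linearCoeff_nodeVar (i j : Fin 2) :
    linearCoeff i (nodeVar k j) = if i = j then 1 else 0 := by
  split_ifs with h
  · subst h; simp [linearCoeff_apply]
  · rw [linearCoeff_apply, branch_nodeVar_of_ne h, map_zero]

theorem linearCoeff_eq_zero_of_dvd {i j : Fin 2} (h : i ≠ j) {z : NodeRing k}
    (hz : nodeVar k j ∣ z) : linearCoeff i z = 0 := by
  rw [linearCoeff_apply, (branch_eq_zero_iff h).2 hz, map_zero]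

/-- The matrix of the action of an automorphism on the cotangent space. -/
def linearPart (e : NodeRing k ≃ₐ[k] NodeRing k) : Matrix (Fin 2) (Fin 2) k :=
  Matrix.of fun i j => linearCoeff j (e (nodeVar k i))

theorem linearPart_apply (e : NodeRing k ≃ₐ[k] NodeRing k) (i j : Fin 2) :
    linearPart e i j = linearCoeff j (e (nodeVar k i)) := rfl

/-- Only the constant terms of the cofactors of the variables contribute to first order, and `e`
preserves those. -/
theorem linearCoeff_map (e : NodeRing k ≃ₐ[k] NodeRing k) (j : Fin 2) {z : NodeRing k}
    (hz : z ∈ IsLocalRing.maximalIdeal (NodeRing k)) :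
    linearCoeff j (e z) = ∑ i, linearCoeff i z * linearPart e i j := by
  obtain ⟨w, rfl⟩ := exists_eq_sum_nodeVar hz
  simp only [map_sum, map_mul]
  refine (Finset.sum_congr rfl fun i _ => linearCoeff_mul j
    ((map_mem_maximalIdeal e).2 (nodeVar_mem_maximalIdeal i))).trans
    (Finset.sum_congr rfl fun i _ => ?_)
  have : ∑ l, linearCoeff i (nodeVar k l * w l) = PowerSeries.constantCoeff (branch i (w i)) := by
    rw [Finset.sum_congr rfl fun l _ => linearCoeff_mul i (nodeVar_mem_maximalIdeal l)]
    simp [linearCoeff_nodeVar]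
  rw [this, constantCoeff_branch_map e j i, mul_comm]
  rfl

/-- The order is reversed because row `i` holds the image of the `i`-th variable. -/
theorem linearPart_mul (e f : NodeRing k ≃ₐ[k] NodeRing k) :
    linearPart (e * f) = linearPart f * linearPart e := by
  ext i j
  rw [Matrix.mul_apply]
  exact linearCoeff_map e j ((map_mem_maximalIdeal f).2 (nodeVar_mem_maximalIdeal i))

theorem linearPart_one : linearPart (1 : NodeRing k ≃ₐ[k] NodeRing k) = 1 := by
  ext i j
  rw [linearPart_apply, AlgEquiv.one_apply, linearCoeff_nodeVar, Matrix.one_apply]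
  simp only [eq_comm]

theorem mem_maximalIdeal_sq_iff {z : NodeRing k}
    (hz : z ∈ IsLocalRing.maximalIdeal (NodeRing k)) :
    z ∈ IsLocalRing.maximalIdeal (NodeRing k) ^ 2 ↔ ∀ i, linearCoeff i z = 0 := by
  constructor
  · intro h i
    rw [pow_two] at h
    refine Submodule.mul_induction_on h (fun a ha b hb => ?_) fun a b ha hb => ?_
    · rw [linearCoeff_mul i ha, (mem_maximalIdeal_iff i).1 hb, mul_zero]
    · rw [map_add, ha, hb, add_zero]
  · intro h
    obtain ⟨w, rfl⟩ := exists_eq_sum_nodeVar hz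
    rw [pow_two]
    refine Ideal.sum_mem _ fun i _ => Ideal.mul_mem_mul (nodeVar_mem_maximalIdeal i) ?_
    rw [mem_maximalIdeal_iff i, ← h i, map_sum,
      Finset.sum_congr rfl fun l _ => linearCoeff_mul i (nodeVar_mem_maximalIdeal l)]
    simp [linearCoeff_nodeVar]

/-! ### The two minimal primes -/

instance isPrime_ker_branch (i : Fin 2) : (RingHom.ker (branch (k := k) i)).IsPrime :=
  RingHom.ker_isPrime (branch (k := k) i)

theorem nodeVar_notMem_ker_branch (i : Fin 2) : nodeVar k i ∉ RingHom.ker (branch (k := k) i) := by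
  rw [RingHom.mem_ker, branch_nodeVar_self]
  exact PowerSeries.X_ne_zero

theorem ker_branch_injective :
    Function.Injective fun i : Fin 2 => RingHom.ker (branch (k := k) i) := by
  intro i j h
  by_contra hij
  refine nodeVar_notMem_ker_branch (k := k) j ?_
  rw [← show RingHom.ker (branch (k := k) i) = RingHom.ker (branch (k := k) j) from h,
    RingHom.mem_ker]
  exact branch_nodeVar_of_ne hij

/-- A prime contains ab = 0, hence one of the variables, which generates the kernel of the other
branch. -/
theorem exists_ker_branch_le (q : Ideal (NodeRing k)) [q.IsPrime] :
    ∃ i, RingHom.ker (branch (k := k) i) ≤ q := by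
  have h : nodeVar k 0 * nodeVar k 1 ∈ q := by
    rw [nodeVar_mul (by simp)]; exact q.zero_mem
  rcases Ideal.IsPrime.mem_or_mem ‹_› h with h | h
  · exact ⟨1, by rwa [ker_branch (j := 0) (by simp), Ideal.span_singleton_le_iff_mem]⟩
  · exact ⟨0, by rwa [ker_branch (j := 1) (by simp), Ideal.span_singleton_le_iff_mem]⟩

theorem mem_minimalPrimes_iff {q : Ideal (NodeRing k)} :
    q ∈ minimalPrimes (NodeRing k) ↔ ∃ i, q = RingHom.ker (branch (k := k) i) := by
  constructor
  · intro h
    have := h.1.1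
    obtain ⟨i, hi⟩ := exists_ker_branch_le q
    exact ⟨i, le_antisymm (h.2 ⟨inferInstance, bot_le⟩ hi) hi⟩
  · rintro ⟨i, rfl⟩
    refine ⟨⟨inferInstance, bot_le⟩, fun q hq hle => ?_⟩
    have := hq.1
    obtain ⟨j, hj⟩ := exists_ker_branch_le q
    rcases eq_or_ne i j with rfl | hij
    · exact hj
    · have h1 : nodeVar k i ∈ RingHom.ker (branch (k := k) j) := branch_nodeVar_of_ne hij.symm
      exact absurd (hle (hj h1)) (nodeVar_notMem_ker_branch i)

theorem exists_comap_ker_branch (e : NodeRing k ≃ₐ[k] NodeRing k) :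
    ∃ s : Equiv.Perm (Fin 2), ∀ i, (RingHom.ker (branch (k := k) i)).comap
      (e.symm : NodeRing k →+* NodeRing k) = RingHom.ker (branch (k := k) (s i)) := by
  choose s hs using fun i => mem_minimalPrimes_iff.1
    (comap_symm_mem_minimalPrimes e (mem_minimalPrimes_iff.2 ⟨i, rfl⟩))
  have hinj : Function.Injective s := by
    intro i j hij
    apply ker_branch_injective (k := k)
    have h := (hs i).trans ((congrArg (fun l => RingHom.ker (branch (k := k) l)) hij).trans
      (hs j).symm)
    refine Ideal.comap_injective_of_surjective (e.symm : NodeRing k →+* NodeRing k)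
      e.symm.surjective h
  exact ⟨Equiv.ofBijective s (Finite.injective_iff_bijective.1 hinj), hs⟩

end NodeRing

/-! ### Permutation of the branches, monomial linear parts and signs. -/

section Branches

variable {k : Type u} [Field k]

theorem nodeVar_dvd_of_comap_ker_branch {e : NodeRing k ≃ₐ[k] NodeRing k}
    {s : Equiv.Perm (Fin 2)} (hs : ∀ i, (RingHom.ker (branch (k := k) i)).comap
      (e.symm : NodeRing k →+* NodeRing k) = RingHom.ker (branch (k := k) (s i))) (i : Fin 2) :
    nodeVar k (s i) ∣ e (nodeVar k i) := by
  obtain ⟨j, hj⟩ : ∃ j, j ≠ i := exists_ne i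
  rw [← branch_eq_zero_iff (s.injective.ne hj), ← RingHom.mem_ker, ← hs j, Ideal.mem_comap]
  simpa using branch_nodeVar_of_ne hj

theorem linearPart_eq_zero_of_comap_ker_branch {e : NodeRing k ≃ₐ[k] NodeRing k}
    {s : Equiv.Perm (Fin 2)} (hs : ∀ i, (RingHom.ker (branch (k := k) i)).comap
      (e.symm : NodeRing k →+* NodeRing k) = RingHom.ker (branch (k := k) (s i))) {i j : Fin 2}
    (h : j ≠ s i) : linearPart e i j = 0 :=
  linearCoeff_eq_zero_of_dvd h (nodeVar_dvd_of_comap_ker_branch hs i)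

/-- A nonzero entry shows where the inverse sends the `i`-th variable; since the two linear parts
are mutually inverse monomial matrices, `e` must send the `j`-th variable back into the ideal of the
`i`-th. This is the form needed for averaging. -/
theorem nodeVar_dvd_of_linearPart_symm_ne_zero {e : NodeRing k ≃ₐ[k] NodeRing k} {i j : Fin 2}
    (h : linearPart e.symm i j ≠ 0) : nodeVar k i ∣ e (nodeVar k j) := by
  obtain ⟨s, hs⟩ := exists_comap_ker_branch e
  obtain ⟨t, ht⟩ := exists_comap_ker_branch e.symm
  have hj : j = t i := not_imp_comm.1 (linearPart_eq_zero_of_comap_ker_branch ht) h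
  have h1 : (linearPart e.symm * linearPart e) i i = 1 := by
    rw [← linearPart_mul, show e * e.symm = 1 from mul_inv_cancel e, linearPart_one,
      Matrix.one_apply_eq]
  rw [Matrix.mul_apply, Finset.sum_eq_single j] at h1
  · have hi : i = s j := by
      refine not_imp_comm.1 (linearPart_eq_zero_of_comap_ker_branch hs) fun h0 => ?_
      simp [h0] at h1
    have := nodeVar_dvd_of_comap_ker_branch hs j
    rwa [← hi] at this
  · intro l _ hl
    rw [linearPart_eq_zero_of_comap_ker_branch ht (by rwa [← hj]), zero_mul]
  · simp

theorem permSign_eq_sign {α : Type u} (f : Equiv.Perm α) (g : Fin 2 ≃ α) (s : Equiv.Perm (Fin 2))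
    (h : ∀ i, f (g i) = g (s i)) : permSign f = Equiv.Perm.sign s := by
  classical
  have hα : Finite α := Finite.of_equiv _ g
  let : Fintype α := Fintype.ofFinite α
  rw [permSign, dif_pos hα, Equiv.Perm.sign_eq_sign_of_equiv s f g fun i => (h i).symm]

variable {A : Type u} [CommRing A] [Algebra k A] (φ : A ≃ₐ[k] NodeRing k)

/-- The two minimal primes of a ring isomorphic to `k[[a, b]]/(ab)`. -/
def minimalPrimesEquiv : Fin 2 ≃ minimalPrimes A :=
  Equiv.ofBijective
    (fun i => ⟨(RingHom.ker (branch (k := k) i)).comap (φ : A →+* NodeRing k), by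
      have := (mem_minimalPrimes_iff (k := k)).2 ⟨i, rfl⟩
      refine ⟨⟨Ideal.comap_isPrime _ _, bot_le⟩, fun q hq hle => ?_⟩
      have hq1 := hq.1
      have h1 : q.comap (φ.symm : NodeRing k →+* A) ≤ RingHom.ker (branch (k := k) i) := by
        intro x hx
        simpa using hle (Ideal.mem_comap.1 hx)
      have h2 := this.2 ⟨Ideal.comap_isPrime _ _, bot_le⟩ h1
      intro x hx
      simpa using h2 (Ideal.mem_comap.1 hx)⟩) (by
    constructor
    · intro i j h
      refine ker_branch_injective (k := k)
        (Ideal.comap_injective_of_surjective (φ : A →+* NodeRing k) φ.surjective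
          (congrArg Subtype.val h))
    · rintro ⟨q, hq⟩
      have hq1 := hq.1.1
      obtain ⟨i, hi⟩ := exists_ker_branch_le (q.comap (φ.symm : NodeRing k →+* A))
      refine ⟨i, Subtype.ext ?_⟩
      have hle : (RingHom.ker (branch (k := k) i)).comap (φ : A →+* NodeRing k) ≤ q := by
        intro x hx
        simpa using hi (Ideal.mem_comap.1 hx)
      exact le_antisymm hle (hq.2 ⟨Ideal.comap_isPrime _ _, bot_le⟩ hle))

theorem permSign_minimalPrimesPerm (e : A ≃ₐ[k] A) {s : Equiv.Perm (Fin 2)}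
    (hs : ∀ i, (RingHom.ker (branch (k := k) i)).comap
      ((φ.symm.trans (e.trans φ)).symm : NodeRing k →+* NodeRing k) =
        RingHom.ker (branch (k := k) (s i))) :
    permSign (α := minimalPrimes A) (minimalPrimesPerm e) = Equiv.Perm.sign s := by
  refine permSign_eq_sign _ (minimalPrimesEquiv φ) s fun i => Subtype.ext ?_
  change ((RingHom.ker (branch (k := k) i)).comap (φ : A →+* NodeRing k)).comap
    (e.symm : A →+* A) = (RingHom.ker (branch (k := k) (s i))).comap (φ : A →+* NodeRing k)
  rw [← hs i]
  ext x
  simp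

/-- The right-hand side is the permanent, which for a monomial matrix is the determinant with the
sign of `s` removed. No assumption on the characteristic enters. -/
theorem det_eq_sign_iff (M : Matrix (Fin 2) (Fin 2) k) (s : Equiv.Perm (Fin 2))
    (h : ∀ i j, j ≠ s i → M i j = 0) :
    M.det = ((Equiv.Perm.sign s : ℤ) : k) ↔ M 0 0 * M 1 1 + M 0 1 * M 1 0 = 1 := by
  have hs : s = 1 ∨ s = Equiv.swap 0 1 := by clear h; revert s; decide
  rw [Matrix.det_fin_two]
  rcases hs with rfl | rfl
  · simp [h 0 1 (by simp)]
  · simp [h 0 0 (by simp), neg_eq_iff_eq_neg]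

end Branches

/-! ### The determinant on the cotangent space, in node coordinates. -/

section Cotangent

variable {k : Type u} [Field k] {A : Type u} [CommRing A] [IsLocalRing A] [Algebra k A]

/-- The completion is local by transport along `φ`, and the kernel of the surjection onto the
residue field is maximal, so it is the only candidate. -/
theorem comap_maximalIdeal_eq_maxIdeal (φ : Completion A ≃ₐ[k] NodeRing k) :
    (IsLocalRing.maximalIdeal (NodeRing k)).comap (φ : Completion A →+* NodeRing k) =
      maxIdeal A := by
  have : IsLocalRing (Completion A) := (φ.symm : NodeRing k ≃+* Completion A).isLocalRing
  have h1 : (maxIdeal A).IsMaximal := by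
    let := Ideal.Quotient.field (IsLocalRing.maximalIdeal A)
    exact RingHom.ker_isMaximal_of_surjective
      (AdicCompletion.evalOneₐ (IsLocalRing.maximalIdeal A)) (AdicCompletion.evalOneₐ_surjective _)
  rw [IsLocalRing.eq_maximalIdeal h1]
  ext x
  simp [IsLocalRing.mem_maximalIdeal, mem_nonunits_iff]

theorem mem_maxIdeal_iff (φ : Completion A ≃ₐ[k] NodeRing k) {x : Completion A} :
    x ∈ maxIdeal A ↔ φ x ∈ IsLocalRing.maximalIdeal (NodeRing k) := by
  rw [← comap_maximalIdeal_eq_maxIdeal φ]; rfl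

/-- The coordinates on the cotangent space given by an isomorphism with `k[[a, b]]/(ab)`. -/
def cotangentCoord (φ : Completion A ≃ₐ[k] NodeRing k) :
    (maxIdeal A).Cotangent →ₗ[k] (Fin 2 → k) :=
  Ideal.Cotangent.lift
    (LinearMap.pi fun i => linearCoeff i ∘ₗ φ.toLinearMap ∘ₗ
      ((maxIdeal A).subtype.restrictScalars k)) fun x y => by
    ext i
    have hx := (mem_maxIdeal_iff φ).1 x.2
    have hy := (mem_maxIdeal_iff φ).1 y.2
    change linearCoeff i (φ (x * y)) = 0
    rw [map_mul, linearCoeff_mul i hx, (mem_maximalIdeal_iff i).1 hy, mul_zero]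

theorem cotangentCoord_apply (φ : Completion A ≃ₐ[k] NodeRing k) (x : maxIdeal A) (i : Fin 2) :
    cotangentCoord φ ((maxIdeal A).toCotangent x) i = linearCoeff i (φ x) := rfl

theorem maxIdeal_sq_iff (φ : Completion A ≃ₐ[k] NodeRing k) {x : Completion A} :
    x ∈ maxIdeal A ^ 2 ↔ φ x ∈ IsLocalRing.maximalIdeal (NodeRing k) ^ 2 := by
  have : maxIdeal A ^ 2 = ((IsLocalRing.maximalIdeal (NodeRing k)) ^ 2).comap
      (φ : Completion A ≃+* NodeRing k) := by
    rw [← Ideal.map_symm, Ideal.map_pow, Ideal.map_symm, ← comap_maximalIdeal_eq_maxIdeal φ]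
    rfl
  rw [this]; rfl

theorem cotangentCoord_bijective (φ : Completion A ≃ₐ[k] NodeRing k) :
    Function.Bijective (cotangentCoord φ) := by
  constructor
  · rw [injective_iff_map_eq_zero]
    intro y hy
    obtain ⟨x, rfl⟩ := Ideal.toCotangent_surjective _ y
    rw [Ideal.toCotangent_eq_zero, maxIdeal_sq_iff φ,
      mem_maximalIdeal_sq_iff ((mem_maxIdeal_iff φ).1 x.2)]
    exact fun i => congrFun hy i
  · intro c
    refine ⟨(maxIdeal A).toCotangent ⟨φ.symm (∑ i, c i • nodeVar k i), ?_⟩, ?_⟩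
    · rw [mem_maxIdeal_iff φ, AlgEquiv.apply_symm_apply]
      exact Ideal.sum_mem _ fun i _ => Submodule.smul_of_tower_mem _ _ (nodeVar_mem_maximalIdeal i)
    · ext i
      rw [cotangentCoord_apply, AlgEquiv.apply_symm_apply]
      simp only [map_sum, map_smul, linearCoeff_nodeVar, smul_eq_mul, mul_ite, mul_one, mul_zero,
        Finset.sum_ite_eq, Finset.mem_univ, if_true]

theorem det_cotangentAction (φ : Completion A ≃ₐ[k] NodeRing k) (e : A ≃ₐ[k] A) :
    LinearMap.det (cotangentAction e) =
      (linearPart (φ.symm.trans ((completionAut e).trans φ))).det := by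
  set M := linearPart (φ.symm.trans ((completionAut e).trans φ)) with hM
  let L := LinearEquiv.ofBijective (cotangentCoord φ) (cotangentCoord_bijective φ)
  -- The transpose turns images stored in rows into columns; the determinant does not see it.
  have h : (L : _ →ₗ[k] _) ∘ₗ cotangentAction e ∘ₗ (L.symm : _ →ₗ[k] _) =
      Matrix.toLin' M.transpose := by
    rw [← LinearMap.comp_assoc, LinearEquiv.comp_toLinearMap_symm_eq]
    ext y j
    obtain ⟨x, rfl⟩ := Ideal.toCotangent_surjective _ y
    change linearCoeff j (φ (completionAut e x)) =
      (M.transpose.mulVec (cotangentCoord φ ((maxIdeal A).toCotangent x))) j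
    have := linearCoeff_map (φ.symm.trans ((completionAut e).trans φ)) j
      ((mem_maxIdeal_iff φ).1 x.2)
    simp only [AlgEquiv.trans_apply, AlgEquiv.symm_apply_apply] at this
    rw [this, Matrix.mulVec, dotProduct]
    refine Finset.sum_congr rfl fun i _ => ?_
    rw [cotangentCoord_apply, Matrix.transpose_apply, mul_comm]
  rw [← LinearMap.det_conj _ L, h, LinearMap.det_toLin', Matrix.det_transpose]

theorem det_cotangentAction_eq_permSign_iff (φ : Completion A ≃ₐ[k] NodeRing k) (e : A ≃ₐ[k] A) :
    LinearMap.det (cotangentAction e) =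
        ((permSign (α := minimalPrimes (Completion A))
          (minimalPrimesPerm (completionAut e)) : ℤ) : k) ↔
      linearPart (φ.symm.trans ((completionAut e).trans φ)) 0 0 *
          linearPart (φ.symm.trans ((completionAut e).trans φ)) 1 1 +
        linearPart (φ.symm.trans ((completionAut e).trans φ)) 0 1 *
          linearPart (φ.symm.trans ((completionAut e).trans φ)) 1 0 = 1 := by
  obtain ⟨s, hs⟩ := exists_comap_ker_branch (φ.symm.trans ((completionAut e).trans φ))
  rw [det_cotangentAction φ, permSign_minimalPrimesPerm φ _ hs]
  exact det_eq_sign_iff _ s fun i j h => linearPart_eq_zero_of_comap_ker_branch hs h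

end Cotangent

/-! ### Linearising a finite action on the node and lifting it to k[[a,b]]. -/

section Lift

open MvPowerSeries

variable {k : Type u} [Field k]

theorem algHom_ext_nodeRing {F G : PowerSeriesRing k →ₐ[k] NodeRing k}
    (hF : ∀ i, F (X i) ∈ IsLocalRing.maximalIdeal (NodeRing k)) (h : ∀ i, F (X i) = G (X i)) :
    F = G :=
  algHom_ext_of_iInf_pow_eq_bot iInf_maximalIdeal_pow hF h

/-- Automorphisms of `k[[a, b]]/(ab)` can be prescribed on the variables, as long as each of them
is multiplied by a function with constant term `1`. -/
theorem exists_algEquiv_nodeVar {x : Fin 2 → NodeRing k} (hx : ∀ i, nodeVar k i ∣ x i)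
    (hx1 : ∀ i, linearCoeff i (x i) = 1) :
    ∃ Ψ : NodeRing k ≃ₐ[k] NodeRing k, ∀ i, Ψ (nodeVar k i) = x i := by
  choose u hu using hx
  choose U hU using fun i => Ideal.Quotient.mk_surjective (u i)
  have hU1 (i) : constantCoeff (U i) = 1 := by
    rw [← hx1 i, hu i, linearCoeff_mul i (nodeVar_mem_maximalIdeal i), linearCoeff_nodeVar,
      if_pos rfl, one_mul, ← hU i, branch_mk, constantCoeff_axis]
  let F : PowerSeriesRing k →ₐ[k] PowerSeriesRing k := substHom (fun i => U i * X i) (by simp)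
  have hF (i) : F (X i) = U i * X i := substHom_X _ _ i
  let E := AlgEquiv.ofBijective F (bijective_of_map_X hU1 hF)
  -- `E` multiplies ab by the unit `U 0 * U 1`, so it descends to the node.
  have hE : Ideal.span {ab k} = (Ideal.span {ab k}).map (E : PowerSeriesRing k →+* _) := by
    rw [Ideal.map_span, Set.image_singleton]
    have : E (ab k) = U 0 * U 1 * ab k := by
      change F (ab k) = _
      rw [ab, map_mul, hF, hF]
      ring
    change _ = Ideal.span {E (ab k)}
    rw [this]
    refine (Ideal.span_singleton_mul_left_unit ?_ _).symm
    rw [MvPowerSeries.isUnit_iff_constantCoeff, map_mul, hU1, hU1]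
    simp
  refine ⟨Ideal.quotientEquivAlg _ _ E hE, fun i => ?_⟩
  rw [hu, ← hU]
  change Ideal.Quotient.mk _ (F (X i)) = _
  rw [hF, map_mul, mul_comm]
  rfl

/-- The linear substitution `X i ↦ ∑ j, M i j X j`. -/
def linearSubst (M : Matrix (Fin 2) (Fin 2) k) : PowerSeriesRing k →ₐ[k] PowerSeriesRing k :=
  substHom (fun i => ∑ j, M i j • X j) fun i => by simp

theorem linearSubst_X (M : Matrix (Fin 2) (Fin 2) k) (i : Fin 2) :
    linearSubst M (X i) = ∑ j, M i j • X j := substHom_X _ _ i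

theorem constantCoeff_linearSubst_X (M : Matrix (Fin 2) (Fin 2) k) (i : Fin 2) :
    constantCoeff (linearSubst M (X i)) = 0 := by
  simp [linearSubst_X]

theorem linearSubst_one : linearSubst (1 : Matrix (Fin 2) (Fin 2) k) = AlgHom.id k _ := by
  refine algHom_ext_powerSeriesRing (constantCoeff_linearSubst_X _) fun i => ?_
  rw [linearSubst_X, AlgHom.id_apply]
  simp only [Matrix.one_apply, ite_smul, one_smul, zero_smul, Finset.sum_ite_eq, Finset.mem_univ,
    if_true]

/-- This reversal cancels the one in `linearPart_mul`, so that `linearAction` is a homomorphism. -/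
theorem linearSubst_mul (M N : Matrix (Fin 2) (Fin 2) k) :
    linearSubst (N * M) = (linearSubst M).comp (linearSubst N) := by
  refine algHom_ext_powerSeriesRing (constantCoeff_linearSubst_X _) fun i => ?_
  simp only [AlgHom.comp_apply, linearSubst_X, map_sum, map_smul, Matrix.mul_apply,
    Finset.sum_smul, Finset.smul_sum, smul_smul]
  exact Finset.sum_comm

variable {H : Type*} [Group H]

/-- The linearisation of an action on `k[[a, b]]/(ab)`, as an action on `k[[a, b]]`. -/
def linearAction (θ : H →* (NodeRing k ≃ₐ[k] NodeRing k)) :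
    H →* (PowerSeriesRing k ≃ₐ[k] PowerSeriesRing k) :=
  (AlgEquiv.algHomUnitsEquiv k (PowerSeriesRing k)).toMonoidHom.comp
    (MonoidHom.toHomUnits
      { toFun := fun σ => linearSubst (linearPart (θ σ))
        map_one' := by rw [map_one, linearPart_one, linearSubst_one]; rfl
        map_mul' := fun σ τ => by rw [map_mul, linearPart_mul, linearSubst_mul]; rfl })

/-- These products are the coefficients of a² and b² in the image of ab under the linear
substitution; they vanish because the two variables go to different branches. -/
theorem linearPart_mul_linearPart_eq_zero (e : NodeRing k ≃ₐ[k] NodeRing k) (j : Fin 2) :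
    linearPart e 0 j * linearPart e 1 j = 0 := by
  obtain ⟨s, hs⟩ := exists_comap_ker_branch e
  by_cases h : j = s 0
  · rw [linearPart_eq_zero_of_comap_ker_branch hs (i := 1), mul_zero]
    rw [h]
    exact s.injective.ne (by simp)
  · rw [linearPart_eq_zero_of_comap_ker_branch hs h, zero_mul]

theorem linearSubst_linearPart_ab {e : NodeRing k ≃ₐ[k] NodeRing k}
    (h : linearPart e 0 0 * linearPart e 1 1 + linearPart e 0 1 * linearPart e 1 0 = 1) :
    linearSubst (linearPart e) (ab k) = ab k := by
  have h0 := congrArg (C (σ := Fin 2)) (linearPart_mul_linearPart_eq_zero e 0)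
  have h1 := congrArg (C (σ := Fin 2)) (linearPart_mul_linearPart_eq_zero e 1)
  have h2 := congrArg (C (σ := Fin 2)) h
  simp only [map_mul, map_add, map_one, map_zero] at h0 h1 h2
  rw [ab, map_mul, linearSubst_X, linearSubst_X]
  simp only [Fin.sum_univ_two, MvPowerSeries.smul_eq_C_mul]
  linear_combination (X 0 ^ 2 : PowerSeriesRing k) * h0 + (X 1 ^ 2 : PowerSeriesRing k) * h1 +
    (X 0 * X 1 : PowerSeriesRing k) * h2

variable [Finite H]

/-- The average of a variable with respect to the action twisted by the inverse of its
linearisation. -/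
def averagedVar (θ : H →* (NodeRing k ≃ₐ[k] NodeRing k)) (i : Fin 2) : NodeRing k :=
  letI := Fintype.ofFinite H
  (Nat.card H : k)⁻¹ • ∑ σ : H, ∑ j, linearPart (θ σ⁻¹) i j • θ σ (nodeVar k j)

/-- Reindex the average by σ ↦ τσ; the weight becomes the linear part of σ⁻¹τ, from which the matrix
of τ factors out on the left. -/
theorem map_averagedVar (θ : H →* (NodeRing k ≃ₐ[k] NodeRing k)) (τ : H) (i : Fin 2) :
    θ τ (averagedVar θ i) = ∑ l, linearPart (θ τ) i l • averagedVar θ l := by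
  let := Fintype.ofFinite H
  have h : ∑ σ : H, ∑ j, linearPart (θ σ⁻¹) i j • θ (τ * σ) (nodeVar k j) =
      ∑ σ : H, ∑ j, linearPart (θ (σ⁻¹ * τ)) i j • θ σ (nodeVar k j) :=
    Fintype.sum_equiv (Equiv.mulLeft τ) _ _ fun σ => by simp
  have e : ∀ l, linearPart (θ τ) i l • averagedVar θ l = (Nat.card H : k)⁻¹ •
      ∑ σ : H, ∑ j, (linearPart (θ τ) i l * linearPart (θ σ⁻¹) l j) • θ σ (nodeVar k j) := by
    intro l
    rw [averagedVar, smul_comm, Finset.smul_sum]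
    simp only [Finset.smul_sum, smul_smul]
  rw [Finset.sum_congr rfl fun l _ => e l, ← Finset.smul_sum, averagedVar, map_smul, map_sum]
  congr 1
  rw [Finset.sum_comm]
  refine Eq.trans ?_ (h.trans ?_)
  · simp only [map_sum, map_smul, map_mul, AlgEquiv.mul_apply]
  · refine Finset.sum_congr rfl fun σ _ => ?_
    rw [Finset.sum_comm]
    refine Finset.sum_congr rfl fun j _ => ?_
    rw [map_mul, linearPart_mul, Matrix.mul_apply, Finset.sum_smul]

theorem nodeVar_dvd_averagedVar (θ : H →* (NodeRing k ≃ₐ[k] NodeRing k)) (i : Fin 2) :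
    nodeVar k i ∣ averagedVar θ i := by
  refine dvd_smul_of_dvd _ (Finset.dvd_sum fun σ _ => Finset.dvd_sum fun j _ => ?_)
  by_cases h : linearPart (θ σ⁻¹) i j = 0
  · rw [h, zero_smul]
    exact dvd_zero _
  · rw [map_inv] at h ⊢
    exact dvd_smul_of_dvd _ (nodeVar_dvd_of_linearPart_symm_ne_zero h)

/-- Each group element contributes a diagonal entry of a matrix times its inverse, hence 1. The
average is thus tangent to the original variable, and this is where the group order must be
invertible. -/
theorem linearCoeff_averagedVar (hH : (Nat.card H : k) ≠ 0)
    (θ : H →* (NodeRing k ≃ₐ[k] NodeRing k)) (i : Fin 2) :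
    linearCoeff i (averagedVar θ i) = 1 := by
  let := Fintype.ofFinite H
  have h (σ : H) : ∑ j, linearPart (θ σ⁻¹) i j * linearPart (θ σ) j i = 1 := by
    rw [← Matrix.mul_apply, ← linearPart_mul, ← map_mul, mul_inv_cancel, map_one, linearPart_one,
      Matrix.one_apply_eq]
  rw [averagedVar, map_smul, map_sum]
  simp only [map_sum, map_smul, smul_eq_mul, ← linearPart_apply]
  rw [Finset.sum_congr rfl fun σ _ => h σ, Finset.sum_const, Finset.card_univ,
    ← Nat.card_eq_fintype_card, nsmul_one, inv_mul_cancel₀ hH]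

/-- A finite group of order invertible in `k` acting on `k[[a, b]]/(ab)` acts linearly in
suitable coordinates. -/
theorem exists_linearise (hH : (Nat.card H : k) ≠ 0) (θ : H →* (NodeRing k ≃ₐ[k] NodeRing k)) :
    ∃ Ψ : NodeRing k ≃ₐ[k] NodeRing k, ∀ (σ : H) (f : PowerSeriesRing k),
      Ψ (Ideal.Quotient.mk _ (linearAction θ σ f)) = θ σ (Ψ (Ideal.Quotient.mk _ f)) := by
  obtain ⟨Ψ, hΨ⟩ := exists_algEquiv_nodeVar (nodeVar_dvd_averagedVar θ)
    (linearCoeff_averagedVar hH θ)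
  refine ⟨Ψ, fun σ f => ?_⟩
  let Q : PowerSeriesRing k →ₐ[k] NodeRing k := Ideal.Quotient.mkₐ k _
  have hQ (i) : Q (X i) = nodeVar k i := rfl
  have hl (i) : Ψ (Q (linearSubst (linearPart (θ σ)) (X i))) = θ σ (Ψ (nodeVar k i)) := by
    rw [hΨ, map_averagedVar, linearSubst_X]
    simp only [map_sum, map_smul, hQ, hΨ]
  have key : ((Ψ : NodeRing k →ₐ[k] NodeRing k).comp
      (Q.comp (linearSubst (linearPart (θ σ))))) =
      (θ σ : NodeRing k →ₐ[k] NodeRing k).comp ((Ψ : NodeRing k →ₐ[k] NodeRing k).comp Q) := by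
    refine algHom_ext_nodeRing (fun i => ?_) hl
    exact (hl i).symm ▸ (map_mem_maximalIdeal (θ σ)).2
      ((map_mem_maximalIdeal Ψ).2 (nodeVar_mem_maximalIdeal i))
  exact congrArg (fun F => F f) key

/-- Compare coefficients of ab. The equation has to hold in k[[a,b]]: modulo ab it would only say
that the product is 0. -/
theorem linearCoeff_mk_of_mul_eq_ab {p q : PowerSeriesRing k} (hp : constantCoeff p = 0)
    (hq : constantCoeff q = 0) (h : p * q = ab k) :
    linearCoeff 0 (Ideal.Quotient.mk (Ideal.span {ab k}) p) *
        linearCoeff 1 (Ideal.Quotient.mk (Ideal.span {ab k}) q) +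
      linearCoeff 1 (Ideal.Quotient.mk (Ideal.span {ab k}) p) *
        linearCoeff 0 (Ideal.Quotient.mk (Ideal.span {ab k}) q) = 1 := by
  classical
  have lin (g : Fin 2 → PowerSeriesRing k) (i : Fin 2) :
      linearCoeff i (Ideal.Quotient.mk (Ideal.span {ab k}) (X 0 * g 0 + X 1 * g 1)) =
        constantCoeff (g i) := by
    have : Ideal.Quotient.mk (Ideal.span {ab k}) (X 0 * g 0 + X 1 * g 1) =
      ∑ l, nodeVar k l * Ideal.Quotient.mk _ (g l) := by simp [nodeVar]
    rw [this, map_sum,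
      Finset.sum_congr rfl fun l _ => linearCoeff_mul i (nodeVar_mem_maximalIdeal l)]
    simp only [linearCoeff_nodeVar, branch_mk, constantCoeff_axis, ite_mul, one_mul, zero_mul,
      Finset.sum_ite_eq, Finset.mem_univ, if_true]
  obtain ⟨g, hg, -⟩ := exists_eq_C_add p 0 (by simp)
  obtain ⟨l, hl, -⟩ := exists_eq_C_add q 0 (by simp)
  rw [hp, map_zero, zero_add] at hg
  rw [hq, map_zero, zero_add] at hl
  rw [hg, hl, lin, lin, lin, lin]
  let m : Fin 2 →₀ ℕ := Finsupp.single 0 1 + Finsupp.single 1 1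
  have hm : (X 0 * X 1 : PowerSeriesRing k) = monomial m 1 := by
    rw [X, X, monomial_mul_monomial, one_mul]
  have hsq (i : Fin 2) (f : PowerSeriesRing k) : coeff m (X i ^ 2 * f) = 0 := by
    refine X_pow_dvd_iff.1 (dvd_mul_right _ f) m ?_
    fin_cases i <;> simp [m]
  have hab (f : PowerSeriesRing k) : coeff m (X 0 * X 1 * f) = constantCoeff f := by
    rw [hm]
    have := coeff_add_monomial_mul m 0 f (1 : k)
    rwa [add_zero, one_mul, coeff_zero_eq_constantCoeff_apply] at this
  have e : p * q = X 0 ^ 2 * (g 0 * l 0) + X 1 ^ 2 * (g 1 * l 1) +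
      X 0 * X 1 * (g 0 * l 1 + g 1 * l 0) := by
    rw [hg, hl]; ring
  have := congrArg (coeff m) (e.symm.trans h)
  rw [map_add, map_add, hsq, hsq, hab, zero_add, zero_add, ab, ← mul_one (X 0 * X 1), hab] at this
  simpa using this

end Lift

end

end SemistableCurve

open SemistableCurve
theorem proposition4 {k : Type u} [Field k] [IsAlgClosed k]
    (C : Over (Spec (CommRingCat.of k))) (hC : IsSemistable C)
    (G : Subgroup (Aut C)) [Finite G] (hG : (Nat.card G : k) ≠ 0)
    (hfaithful : FaithfulOnComponents C G)
    (P : C.left) (hP : IsSingularPoint C P) :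
    OrientationPreservingAt G P ↔
      ∃ (φ : CompletedLocalRing C P ≃ₐ[k] NodeRing k)
        (ρ : Stab G P →* (PowerSeriesRing k ≃ₐ[k] PowerSeriesRing k)),
        (∀ (σ : Stab G P) (f : PowerSeriesRing k),
          Ideal.Quotient.mk (Ideal.span {ab k}) (ρ σ f) =
            φ (completedAction G P σ (φ.symm (Ideal.Quotient.mk (Ideal.span {ab k}) f)))) ∧
        ∀ σ : Stab G P, ρ σ (ab k) = ab k := by
  have orient (φ : CompletedLocalRing C P ≃ₐ[k] NodeRing k) :
      OrientationPreservingAt G P ↔ ∀ σ : Stab G P,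
        linearPart (AlgEquiv.autCongr φ (completedAction G P σ)) 0 0 *
          linearPart (AlgEquiv.autCongr φ (completedAction G P σ)) 1 1 +
        linearPart (AlgEquiv.autCongr φ (completedAction G P σ)) 0 1 *
          linearPart (AlgEquiv.autCongr φ (completedAction G P σ)) 1 0 = 1 :=
    forall_congr' fun σ => det_cotangentAction_eq_permSign_iff φ (stalkAction G P σ)
  constructor
  · intro h
    obtain ⟨φ⟩ := hC.nodal P hP
    have hle : Stab G P ≤ G := fun g hg => hg.1
    have : Finite (Stab G P) := Finite.of_injective _ (Subgroup.inclusion_injective hle)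
    have hcard : (Nat.card (Stab G P) : k) ≠ 0 := by
      obtain ⟨c, hc⟩ := Subgroup.card_dvd_of_le hle
      rw [hc, Nat.cast_mul] at hG
      exact left_ne_zero_of_mul hG
    let θ : Stab G P →* (NodeRing k ≃ₐ[k] NodeRing k) :=
      (AlgEquiv.autCongr φ).toMonoidHom.comp (completedAction G P)
    obtain ⟨Ψ, hΨ⟩ := exists_linearise hcard θ
    -- `Ψ` carries the old variables to the linearising ones, so its inverse reads off the new
    -- coordinates.
    refine ⟨φ.trans Ψ.symm, linearAction θ, fun σ f => ?_,
      fun σ => linearSubst_linearPart_ab ((orient φ).1 h σ)⟩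
    exact Ψ.eq_symm_apply.2 (hΨ σ f)
  · rintro ⟨φ, ρ, hρ, hab⟩
    refine (orient φ).2 fun σ => ?_
    have hX (i) : AlgEquiv.autCongr φ (completedAction G P σ) (nodeVar k i) =
        Ideal.Quotient.mk _ (ρ σ (MvPowerSeries.X i)) := (hρ σ _).symm
    -- The constant term survives modulo ab, where an automorphism preserves the maximal ideal.
    have hc (i) : MvPowerSeries.constantCoeff (ρ σ (MvPowerSeries.X i)) = 0 := by
      rw [← constantCoeff_axis 0, ← branch_mk, ← hX, ← mem_maximalIdeal_iff, map_mem_maximalIdeal]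
      exact nodeVar_mem_maximalIdeal i
    simp only [linearPart_apply, hX]
    refine linearCoeff_mk_of_mul_eq_ab (hc 0) (hc 1) ?_
    rw [← map_mul]
    exact hab σ
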